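/- Let $\mathbb D$ be the open unit disc, $\mathbb T$ the unit circle, and $m$ the normalized Lebesgue measure on $\mathbb T$. Let $\mu$ be a positive Borel measure on $\mathbb D$ with $\int_{\mathbb D}(1-|w|^2)\,d\mu(w)<\infty$, and put $$V_\mu(z)=\int_{\mathbb D}\frac{(1-|z|^2)(1-|w|^2)}{|1-z\bar w|^2}\,d\mu(w)\quad(z\in\mathbb D),\qquad A_\mu(\zeta,\lambda)=\int_{\mathbb D}\frac{1-|z|^2}{|\zeta-z|^2}\cdot\frac{1-|z|^2}{|\lambda-z|^2}\,d\mu(z)\quad(\zeta,\lambda\in\mathbb T).$$ Let $\mathcal D^h_\mu$ be the space of all $f\in L^2(\mathbb T)$ with $\mathcal D^h_\mu(f):=\int_{\mathbb T}\int_{\mathbb T}|f(\zeta)-f(\lambda)|^2A_\mu(\zeta,\lambda)\,dm(\zeta)\,dm(\lambda)<\infty$, with $\|f\|^2_{\mathcal D^h_\mu}=\|f\|^2_{L^2(\mathbb T)}+\mathcal D^h_\mu(f)$, and for $E\subset\mathbb T$ let $$c_\mu(E)=\inf\{\|f\|^2_{\mathcal D^h_\mu}: f\in\mathcal D^h_\mu,\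 |f|\ge 1\ m\text{-a.e. on a neighbourhood of }E\}.$$ Then, for every $\zeta\in\mathbb T$, $c_\mu(\{\zeta\})=0$ if and only if $$\int_0^1\frac{dr}{(1-r)V_\mu(r\zeta)+(1-r)^2}=\infty.$$ -/

import Mathlib

open MeasureTheory
open scoped ENNReal ComplexConjugate

noncomputable section

namespace DirichletCapacity

/-- The open unit disc, with its Borel sigma-algebra as a subtype of `ℂ`. -/
abbrev Disc : Type := Metric.ball (0 : ℂ) 1

/-- The circle carries its Borel sigma-algebra. -/
instance instMeasurableSpaceCircle : MeasurableSpace Circle := borel Circle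

instance instBorelSpaceCircle : BorelSpace Circle := ⟨rfl⟩

/-- Normalized Lebesgue measure `m` on the unit circle: the image under `t ↦ e^{it}` of
`dt / 2π` on `(-π, π]`. -/
def circleMeasure : Measure Circle :=
  (ENNReal.ofReal (2 * Real.pi))⁻¹ •
    (volume.restrict (Set.Ioc (-Real.pi) Real.pi)).map Circle.exp

/-- The condition `∫_𝔻 (1 - |w|²) dμ(w) < ∞`. -/
def RieszFinite (μ : Measure Disc) : Prop :=
  ∫⁻ w : Disc, ENNReal.ofReal (1 - ‖(w : ℂ)‖ ^ 2) ∂μ < ∞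

/-- `V_μ(z) = ∫_𝔻 (1 - |z|²)(1 - |w|²) / |1 - z w̄|² dμ(w)`, used only for `|z| < 1`. -/
def V (μ : Measure Disc) (z : ℂ) : ℝ≥0∞ :=
  ∫⁻ w : Disc, ENNReal.ofReal
    ((1 - ‖z‖ ^ 2) * (1 - ‖(w : ℂ)‖ ^ 2) / ‖1 - z * conj (w : ℂ)‖ ^ 2) ∂μ

/-- `A_μ(ζ, ξ) = ∫_𝔻 (1 - |z|²)/|ζ - z|² · (1 - |z|²)/|ξ - z|² dμ(z)`. -/
def A (μ : Measure Disc) (ζ ξ : Circle) : ℝ≥0∞ :=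
  ∫⁻ z : Disc, ENNReal.ofReal
    ((1 - ‖(z : ℂ)‖ ^ 2) / ‖(ζ : ℂ) - (z : ℂ)‖ ^ 2 *
      ((1 - ‖(z : ℂ)‖ ^ 2) / ‖(ξ : ℂ) - (z : ℂ)‖ ^ 2)) ∂μ

/-- The Dirichlet integral
`∫_𝕋 ∫_𝕋 |f(ζ) - f(ξ)|² A_μ(ζ, ξ) dm(ζ) dm(ξ)`, with values in `[0, ∞]`. -/
def energy (μ : Measure Disc) (f : Circle → ℂ) : ℝ≥0∞ :=
  ∫⁻ ξ, ∫⁻ ζ, ‖f ζ - f ξ‖ₑ ^ 2 * A μ ζ ξ ∂circleMeasure ∂circleMeasure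

/-- `f` represents an element of the harmonic Dirichlet space: `f ∈ L²(𝕋)` and its Dirichlet
integral is finite. -/
def MemHarmonicDirichlet (μ : Measure Disc) (f : Circle → ℂ) : Prop :=
  MemLp f 2 circleMeasure ∧ energy μ f < ∞

/-- The squared norm of the harmonic Dirichlet space. -/
def normSq (μ : Measure Disc) (f : Circle → ℂ) : ℝ≥0∞ :=
  ∫⁻ ζ, ‖f ζ‖ₑ ^ 2 ∂circleMeasure + energy μ f

/-- The capacity `c_μ(E)`: the infimum of the squared norms of the elements `f` of the harmonic
Dirichlet space with `|f| ≥ 1` almost everywhere on a neighbourhood of `E`. -/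
def capacity (μ : Measure Disc) (E : Set Circle) : ℝ≥0∞ :=
  sInf {c | ∃ f : Circle → ℂ, MemHarmonicDirichlet μ f ∧
    (∃ U : Set Circle, IsOpen U ∧ E ⊆ U ∧ ∀ᵐ ζ ∂circleMeasure, ζ ∈ U → 1 ≤ ‖f ζ‖) ∧
    c = normSq μ f}

end DirichletCapacity

end

/-! The singleton `{ζ}` is approached through a series network whose `k`-th edge has conductance
`C k = 4⁻ᵏ (1 + ∫ T_k dμ)`, where `T_k` is the Poisson kernel of `ζ` truncated at distance `4⁻ᵏ`.
Both sides of the equivalence say that the total resistance `∑ (C k)⁻¹` is infinite. For the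
integral this holds because its denominator is comparable to `4⁻ᵏ C k` for `1 - r` between `4⁻ᵏ⁻¹`
and `4⁻ᵏ`.

For the capacity, the Dirichlet integral of `f` is the `μ`-integral over `w` of twice the variance
of `f` under the harmonic measure at `w`. Comparing the harmonic measures with arc length near `ζ`
bounds `∑ C k * δ_k` by the squared norm of `f`, where `δ_k` is the mean square increment of `f`
between consecutive arcs `(4⁻ᵏ⁻¹, 4⁻ᵏ]` shrinking to `ζ`; by the Cauchy–Schwarz inequality the norm
cannot be small when the resistance is finite. Conversely, the Szegő kernels at the points
`(1 - 4⁻ᵏ)ζ`, normalized at `ζ`, are almost orthogonal, so `∑ a k • kernel k` has squared norm at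
most a constant times `∑ |a k|² C k`, and the infimum of this sum given `∑ a k = 2` is
`4 / ∑ (C k)⁻¹`. -/

noncomputable section

namespace DirichletCapacity

open Set Filter Topology Function
open scoped NNReal

/-! ### Harmonic measures and the Dirichlet integral -/

theorem continuous_circle_coe : Continuous fun ξ : Circle => (ξ : ℂ) := by fun_prop

theorem lintegral_circleMeasure {G : Circle → ℝ≥0∞} (hG : Measurable G) :
    ∫⁻ ξ, G ξ ∂circleMeasure =
      (ENNReal.ofReal (2 * Real.pi))⁻¹ *
        ∫⁻ θ in Ioc (-Real.pi) Real.pi, G (Circle.exp θ) := by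
  rw [circleMeasure, lintegral_smul_measure, smul_eq_mul,
    lintegral_map hG Circle.exp.continuous.measurable]

theorem setLIntegral_Ioc_add_eq_of_periodic {T : ℝ} (hT : 0 < T) {g : ℝ → ℝ≥0∞}
    (hg : Periodic g T) (s t : ℝ) :
    ∫⁻ x in Ioc s (s + T), g x = ∫⁻ x in Ioc t (t + T), g x := by
  have : VAddInvariantMeasure (AddSubgroup.zmultiples T) ℝ volume :=
    ⟨fun c s _ => measure_preimage_add _ _ _⟩
  exact (isAddFundamentalDomain_Ioc hT s).setLIntegral_eq (isAddFundamentalDomain_Ioc hT t) _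
    hg.map_vadd_zmultiples

theorem lintegral_circleMeasure_mul_exp (ζ : Circle) {G : Circle → ℝ≥0∞} (hG : Measurable G)
    (t : ℝ) :
    ∫⁻ ξ, G ξ ∂circleMeasure =
      (ENNReal.ofReal (2 * Real.pi))⁻¹ *
        ∫⁻ θ in Ioc t (t + 2 * Real.pi), G (ζ * Circle.exp θ) := by
  obtain ⟨a, rfl⟩ : ∃ a : ℝ, Circle.exp a = ζ := ⟨_, Circle.exp_arg ζ⟩
  have hper : Periodic (fun θ => G (Circle.exp θ)) (2 * Real.pi) := fun θ => by
    simp only [Circle.periodic_exp θ]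
  have htranslate :=
    (measurePreserving_add_left volume a).setLIntegral_comp_preimage_emb
      (measurableEmbedding_addLeft a) (fun θ => G (Circle.exp θ))
      (Ioc (a + t) (a + t + 2 * Real.pi))
  simp only [preimage_const_add_Ioc, Circle.exp_add, add_assoc, add_sub_cancel_left] at htranslate
  rw [lintegral_circleMeasure hG, htranslate, ← add_assoc,
    setLIntegral_Ioc_add_eq_of_periodic Real.two_pi_pos hper (a + t) (-Real.pi)]
  ring_nf

theorem setLIntegral_mul_exp_le (ζ : Circle) {G : Circle → ℝ≥0∞} (hG : Measurable G) :
    ∫⁻ θ in Ioc (0 : ℝ) 1, G (ζ * Circle.exp θ) ≤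
      ENNReal.ofReal (2 * Real.pi) * ∫⁻ ξ, G ξ ∂circleMeasure := by
  rw [lintegral_circleMeasure_mul_exp ζ hG 0,
    ENNReal.mul_inv_cancel_left (by simpa using Real.pi_pos) ENNReal.ofReal_ne_top]
  exact lintegral_mono_set (Ioc_subset_Ioc le_rfl (by linarith [Real.pi_gt_three]))

instance isProbabilityMeasure_circleMeasure : IsProbabilityMeasure circleMeasure where
  measure_univ := by
    rw [← lintegral_one, lintegral_circleMeasure measurable_const, lintegral_one,
      Measure.restrict_apply_univ, Real.volume_Ioc, sub_neg_eq_add, ← two_mul,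
      ENNReal.inv_mul_cancel (by simpa using Real.pi_pos) ENNReal.ofReal_ne_top]

theorem integral_circleMeasure {E : Type*} [NormedAddCommGroup E] [NormedSpace ℝ E] {f : ℂ → E}
    (hf : Continuous fun ξ : Circle => f ξ) :
    ∫ ξ : Circle, f ξ ∂circleMeasure = Real.circleAverage f 0 1 := by
  rw [Real.circleAverage_eq_integral_add (-Real.pi),
    intervalIntegral.integral_comp_add_right (fun θ => f (circleMap 0 1 θ)), zero_add,
    show 2 * Real.pi + -Real.pi = Real.pi by ring,
    intervalIntegral.integral_of_le (by linarith [Real.pi_pos]), circleMeasure,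
    integral_smul_measure, integral_map Circle.exp.continuous.aemeasurable
      hf.aestronglyMeasurable, ENNReal.toReal_inv, ENNReal.toReal_ofReal Real.two_pi_pos.le]
  simp only [circleMap_zero, Complex.ofReal_one, one_mul, Circle.coe_exp]

theorem integrable_of_continuous {E : Type*} [NormedAddCommGroup E] {f : Circle → E}
    (hf : Continuous f) (ν : Measure Circle) [IsFiniteMeasure ν] : Integrable f ν :=
  hf.integrable_of_hasCompactSupport (HasCompactSupport.of_compactSpace f)

/-- The Szegő kernel `z ↦ (1 - conj a * z)⁻¹` with pole parameter `a`, which reproduces the values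
at `a` of functions holomorphic on the disc. -/
def szego (a z : ℂ) : ℂ := (1 - conj a * z)⁻¹

theorem one_sub_conj_mul_ne_zero {a z : ℂ} (ha : ‖a‖ < 1) (hz : ‖z‖ ≤ 1) : 1 - conj a * z ≠ 0 := by
  refine sub_ne_zero.2 fun h => ?_
  have : ‖conj a * z‖ < 1 := by
    rw [norm_mul, Complex.norm_conj]
    exact mul_lt_one_of_nonneg_of_lt_one_left (norm_nonneg a) ha hz
  rw [← h, norm_one] at this
  exact lt_irrefl _ this

theorem continuous_szego {a : ℂ} (ha : ‖a‖ < 1) : Continuous fun ξ : Circle => szego a ξ :=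
  Continuous.inv₀ (by fun_prop) fun ξ => one_sub_conj_mul_ne_zero ha (Circle.norm_coe ξ).le

theorem diffContOnCl_szego {a : ℂ} (ha : ‖a‖ < 1) :
    DiffContOnCl ℂ (szego a) (Metric.ball 0 1) := by
  refine DifferentiableOn.diffContOnCl fun z hz => ?_
  have : 1 - conj a * z ≠ 0 := one_sub_conj_mul_ne_zero ha
    (mem_closedBall_zero_iff.1 (Metric.closure_ball_subset_closedBall hz))
  unfold szego
  exact DifferentiableAt.differentiableWithinAt (by fun_prop (disch := assumption))

theorem one_sub_conj_mul_circle (w : ℂ) (ξ : Circle) :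
    1 - conj w * (ξ : ℂ) = (ξ : ℂ) * conj ((ξ : ℂ) - w) := by
  rw [map_sub, mul_sub, Complex.mul_conj, Circle.normSq_coe, Complex.ofReal_one, mul_comm]

theorem integral_mul_conj_szego {f : ℂ → ℂ} (hf : DiffContOnCl ℂ f (Metric.ball 0 1)) {b : ℂ}
    (hb : ‖b‖ < 1) : ∫ ξ : Circle, f ξ * conj (szego b ξ) ∂circleMeasure = f b := by
  have hf' : DiffContOnCl ℂ f (Metric.ball 0 |1|) := by rwa [abs_one]
  have hcont : Continuous fun ξ : Circle => f ξ :=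
    hf.continuousOn_ball.comp_continuous continuous_circle_coe fun ξ => by simp [Circle.norm_coe]
  rw [integral_circleMeasure (f := fun z => f z * conj (szego b z))
    (hcont.mul (Complex.continuous_conj.comp (continuous_szego hb))),
    ← hf'.circleAverage_smul_div (w := b) (by simpa using hb)]
  refine Real.circleAverage_congr_sphere fun z hz => ?_
  obtain ⟨ξ, rfl⟩ : ∃ ξ : Circle, (ξ : ℂ) = z :=
    ⟨⟨z, by simpa [Submonoid.unitSphere] using hz⟩, rfl⟩
  simp only [szego, one_sub_conj_mul_circle, map_inv₀, map_mul, Complex.conj_conj,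
    ← Circle.coe_inv_eq_conj, Circle.coe_inv, sub_zero, smul_eq_mul]
  rw [mul_inv, inv_inv]
  ring

theorem norm_disc_lt_one (w : Disc) : ‖(w : ℂ)‖ < 1 := mem_ball_zero_iff.1 w.2

theorem one_sub_norm_sq_pos (w : Disc) : 0 < 1 - ‖(w : ℂ)‖ ^ 2 := by
  nlinarith [norm_disc_lt_one w, norm_nonneg (w : ℂ)]

theorem circle_sub_ne_zero (ξ : Circle) {w : ℂ} (hw : ‖w‖ < 1) : (ξ : ℂ) - w ≠ 0 :=
  sub_ne_zero.2 fun h => hw.ne (h ▸ Circle.norm_coe ξ)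

theorem norm_one_sub_conj_mul_circle (w : ℂ) (ξ : Circle) :
    ‖1 - conj w * (ξ : ℂ)‖ = ‖(ξ : ℂ) - w‖ := by
  rw [one_sub_conj_mul_circle, norm_mul, Circle.norm_coe, one_mul, Complex.norm_conj]

theorem poissonKernel_zero_circle (w : ℂ) (ξ : Circle) :
    poissonKernel 0 w ξ = (1 - ‖w‖ ^ 2) / ‖(ξ : ℂ) - w‖ ^ 2 := by
  simp only [poissonKernel_def, sub_zero, Circle.norm_coe, one_pow]

theorem poissonKernel_disc_nonneg (w : Disc) (ξ : Circle) : 0 ≤ poissonKernel 0 w ξ := by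
  rw [poissonKernel_zero_circle]
  exact div_nonneg (one_sub_norm_sq_pos w).le (by positivity)

theorem measurable_poissonKernel :
    Measurable fun p : Disc × Circle => poissonKernel 0 p.1 p.2 := by
  have : Measurable fun p : Disc × Circle => (p.1 : ℂ) :=
    measurable_subtype_coe.comp measurable_fst
  have : Measurable fun p : Disc × Circle => (p.2 : ℂ) :=
    continuous_circle_coe.measurable.comp measurable_snd
  unfold poissonKernel
  fun_prop

theorem continuous_poissonKernel {w : ℂ} (hw : ‖w‖ < 1) :
    Continuous fun ξ : Circle => poissonKernel 0 w ξ := by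
  simp only [poissonKernel_zero_circle]
  exact Continuous.div (by fun_prop) (by fun_prop) fun ξ => by
    simpa using circle_sub_ne_zero ξ hw

theorem integral_poissonKernel {w : ℂ} (hw : ‖w‖ < 1) :
    ∫ ξ : Circle, poissonKernel 0 w ξ ∂circleMeasure = 1 := by
  have hone : DiffContOnCl ℂ (fun _ : ℂ => (1 : ℂ)) (Metric.ball 0 1) := diffContOnCl_const
  apply Complex.ofReal_injective
  rw [← integral_complex_ofReal, integral_circleMeasure (f := fun z => (poissonKernel 0 w z : ℂ))
    (Complex.continuous_ofReal.comp (continuous_poissonKernel hw))]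
  simpa [Pi.smul_def'] using hone.circleAverage_poissonKernel_smul (mem_ball_zero_iff.2 hw)

/-- The harmonic measure of the disc at `w`: the density of the normalized Lebesgue measure is the
Poisson kernel at `w`. -/
def harmonicMeasure (w : Disc) : Measure Circle :=
  circleMeasure.withDensity fun ξ => ENNReal.ofReal (poissonKernel 0 w ξ)

instance isProbabilityMeasure_harmonicMeasure (w : Disc) :
    IsProbabilityMeasure (harmonicMeasure w) where
  measure_univ := by
    have hw := norm_disc_lt_one w
    rw [harmonicMeasure, withDensity_apply _ MeasurableSet.univ, Measure.restrict_univ,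
      ← ofReal_integral_eq_lintegral_ofReal
        (integrable_of_continuous (continuous_poissonKernel hw) _)
        (ae_of_all _ (poissonKernel_disc_nonneg w)),
      integral_poissonKernel hw, ENNReal.ofReal_one]

theorem lintegral_harmonicMeasure (w : Disc) (F : Circle → ℝ≥0∞) :
    ∫⁻ ξ, F ξ ∂harmonicMeasure w =
      ∫⁻ ξ, F ξ * ENNReal.ofReal (poissonKernel 0 w ξ) ∂circleMeasure := by
  have hP : Measurable fun ξ : Circle => ENNReal.ofReal (poissonKernel 0 w ξ) :=
    (continuous_poissonKernel (norm_disc_lt_one w)).measurable.ennreal_ofReal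
  rw [harmonicMeasure, lintegral_withDensity_eq_lintegral_mul_non_measurable _ hP
    (ae_of_all _ fun _ => ENNReal.ofReal_lt_top)]
  simp only [Pi.mul_apply, mul_comm]

theorem RieszFinite.sigmaFinite {μ : Measure Disc} (hμ : RieszFinite μ) : SigmaFinite μ := by
  let h : Disc → ℝ≥0∞ := fun w => ENNReal.ofReal (1 - ‖(w : ℂ)‖ ^ 2)
  have hmeas : Measurable h := by
    have : Measurable fun w : Disc => (w : ℂ) := measurable_subtype_coe
    fun_prop
  have hpos : ∀ w, h w ≠ 0 := fun w => by simpa [h] using one_sub_norm_sq_pos w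
  have : IsFiniteMeasure (μ.withDensity h) := isFiniteMeasure_withDensity hμ.ne
  rw [← withDensity_inv_same hmeas (ae_of_all μ hpos) (ae_of_all μ fun _ => ENNReal.ofReal_ne_top)]
  exact SigmaFinite.withDensity_of_ne_top (ae_of_all _ fun w => ENNReal.inv_ne_top.2 (hpos w))

theorem A_eq_lintegral_poissonKernel (μ : Measure Disc) (ζ ξ : Circle) :
    A μ ζ ξ = ∫⁻ w : Disc,
      ENNReal.ofReal (poissonKernel 0 w ζ) * ENNReal.ofReal (poissonKernel 0 w ξ) ∂μ := by
  refine lintegral_congr fun w => ?_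
  rw [← ENNReal.ofReal_mul (poissonKernel_disc_nonneg w ζ), poissonKernel_zero_circle,
    poissonKernel_zero_circle]

theorem energy_eq_lintegral_harmonicMeasure {μ : Measure Disc} [SFinite μ] {f : Circle → ℂ}
    (hf : Measurable f) :
    energy μ f =
      ∫⁻ w, ∫⁻ ξ, ∫⁻ ζ, ‖f ζ - f ξ‖ₑ ^ 2 ∂harmonicMeasure w ∂harmonicMeasure w ∂μ := by
  let P : Disc → Circle → ℝ≥0∞ := fun w ξ => ENNReal.ofReal (poissonKernel 0 w ξ)
  let F : (Circle × Disc) × Circle → ℝ≥0∞ := fun p =>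
    ‖f p.2 - f p.1.1‖ₑ ^ 2 * (P p.1.2 p.2 * P p.1.2 p.1.1)
  have hP : Measurable fun p : Disc × Circle => P p.1 p.2 :=
    measurable_poissonKernel.ennreal_ofReal
  have hF : Measurable F := by
    have hfst := hP.comp (f := fun p : (Circle × Disc) × Circle => (p.1.2, p.2)) (by fun_prop)
    have hsnd := hP.comp (f := fun p : (Circle × Disc) × Circle => (p.1.2, p.1.1)) (by fun_prop)
    exact Measurable.mul (by fun_prop) (hfst.mul hsnd)
  calc energy μ f = ∫⁻ ξ, ∫⁻ w, ∫⁻ ζ, F ((ξ, w), ζ) ∂circleMeasure ∂μ ∂circleMeasure := by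
        refine lintegral_congr fun ξ => ?_
        have hFξ : Measurable fun p : Circle × Disc => F ((ξ, p.2), p.1) := hF.comp (by fun_prop)
        rw [← lintegral_lintegral_swap (f := fun ζ w => F ((ξ, w), ζ)) hFξ.aemeasurable]
        refine lintegral_congr fun ζ => ?_
        rw [A_eq_lintegral_poissonKernel, ← lintegral_const_mul' _ _ (by simp)]
    _ = ∫⁻ w, ∫⁻ ξ, ∫⁻ ζ, F ((ξ, w), ζ) ∂circleMeasure ∂circleMeasure ∂μ :=
        lintegral_lintegral_swap hF.lintegral_prod_right'.aemeasurable
    _ = _ := by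
        simp only [lintegral_harmonicMeasure, ← lintegral_mul_const' _ _ ENNReal.ofReal_ne_top,
          mul_assoc, F, P]

/-! ### Discretization of the integral criterion -/

/-- The point at distance `t` from the boundary on the radius of the disc ending at `ζ`. -/
def radialPoint (ζ : Circle) (t : ℝ) : ℂ := ((1 - t : ℝ) : ℂ) * ζ

theorem norm_radialPoint (ζ : Circle) {t : ℝ} (ht : t ≤ 1) : ‖radialPoint ζ t‖ = 1 - t := by
  rw [radialPoint, norm_mul, Circle.norm_coe, mul_one, Complex.norm_of_nonneg (sub_nonneg.2 ht)]

theorem norm_one_sub_conj_radialPoint_mul (ζ : Circle) (t : ℝ) (w : ℂ) :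
    ‖1 - conj (radialPoint ζ t) * w‖ = ‖(ζ : ℂ) - ((1 - t : ℝ) : ℂ) * w‖ := by
  rw [← norm_one_sub_conj_mul_circle, ← Complex.norm_conj, radialPoint]
  simp only [map_sub, map_mul, map_one, Complex.conj_conj, Complex.conj_ofReal]
  ring_nf

theorem norm_one_sub_conj_radialPoint_mul_le (ζ : Circle) {t : ℝ} (ht : 0 ≤ t) {w : ℂ}
    (hw : ‖w‖ ≤ 1) : ‖1 - conj (radialPoint ζ t) * w‖ ≤ t + ‖(ζ : ℂ) - w‖ := by
  calc ‖1 - conj (radialPoint ζ t) * w‖ = ‖(t : ℂ) * w + (ζ - w)‖ := by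
        rw [norm_one_sub_conj_radialPoint_mul]; push_cast; ring_nf
    _ ≤ t * ‖w‖ + ‖(ζ : ℂ) - w‖ := by
        simpa [abs_of_nonneg ht] using norm_add_le ((t : ℂ) * w) (ζ - w)
    _ ≤ t + ‖(ζ : ℂ) - w‖ := by gcongr; exact mul_le_of_le_one_right ht hw

theorem add_norm_sub_le_three_mul (ζ : Circle) {t : ℝ} (ht : 0 ≤ t) (ht1 : t ≤ 1) {w : ℂ}
    (hw : ‖w‖ ≤ 1) : t + ‖(ζ : ℂ) - w‖ ≤ 3 * ‖1 - conj (radialPoint ζ t) * w‖ := by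
  rw [norm_one_sub_conj_radialPoint_mul]
  have ht' : t ≤ ‖(ζ : ℂ) - ((1 - t : ℝ) : ℂ) * w‖ := by
    have h := norm_sub_norm_le (ζ : ℂ) (((1 - t : ℝ) : ℂ) * w)
    rw [norm_mul, Complex.norm_of_nonneg (sub_nonneg.2 ht1), Circle.norm_coe] at h
    nlinarith
  have hsub : ‖(ζ : ℂ) - w‖ ≤ ‖(ζ : ℂ) - ((1 - t : ℝ) : ℂ) * w‖ + t :=
    calc ‖(ζ : ℂ) - w‖ = ‖(ζ - ((1 - t : ℝ) : ℂ) * w) - (t : ℂ) * w‖ := by push_cast; ring_nf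
      _ ≤ ‖(ζ : ℂ) - ((1 - t : ℝ) : ℂ) * w‖ + t * ‖w‖ := by
          simpa [abs_of_nonneg ht] using
            norm_sub_le ((ζ : ℂ) - ((1 - t : ℝ) : ℂ) * w) ((t : ℂ) * w)
      _ ≤ ‖(ζ : ℂ) - ((1 - t : ℝ) : ℂ) * w‖ + t := by
          gcongr; exact mul_le_of_le_one_right ht hw
  linarith

/-- The Poisson kernel of `ζ`, as a function of the point `w` of the disc, truncated at distance `t`
from its singularity. -/
def truncatedPoisson (ζ : Circle) (t : ℝ) (w : Disc) : ℝ≥0∞ :=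
  ENNReal.ofReal ((1 - ‖(w : ℂ)‖ ^ 2) / (t + ‖(ζ : ℂ) - w‖) ^ 2)

theorem measurable_truncatedPoisson (ζ : Circle) (t : ℝ) : Measurable (truncatedPoisson ζ t) := by
  have : Measurable fun w : Disc => (w : ℂ) := measurable_subtype_coe
  unfold truncatedPoisson
  fun_prop

theorem lintegral_truncatedPoisson_lt_top {μ : Measure Disc} (hμ : RieszFinite μ) (ζ : Circle)
    {t : ℝ} (ht : 0 < t) : ∫⁻ w, truncatedPoisson ζ t w ∂μ < ∞ := by
  calc ∫⁻ w, truncatedPoisson ζ t w ∂μ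
      ≤ ∫⁻ w : Disc, ENNReal.ofReal (t ^ 2)⁻¹ * ENNReal.ofReal (1 - ‖(w : ℂ)‖ ^ 2) ∂μ := by
        refine lintegral_mono fun w => ?_
        rw [← ENNReal.ofReal_mul (by positivity), mul_comm, ← div_eq_mul_inv, truncatedPoisson]
        have := (one_sub_norm_sq_pos w).le
        gcongr
        exact le_add_of_nonneg_right (norm_nonneg _)
    _ < ∞ := by
        rw [lintegral_const_mul' _ _ ENNReal.ofReal_ne_top]
        exact ENNReal.mul_lt_top ENNReal.ofReal_lt_top hμ

/-- The truncation scales `4⁻ᵏ`. -/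
def scale (k : ℕ) : ℝ := (1 / 4) ^ k

theorem scale_zero : scale 0 = 1 := pow_zero _

theorem scale_succ (k : ℕ) : scale (k + 1) = scale k / 4 := by
  rw [scale, scale, pow_succ]; ring

theorem scale_pos (k : ℕ) : 0 < scale k := by unfold scale; positivity

theorem scale_le_one (k : ℕ) : scale k ≤ 1 := pow_le_one₀ (by norm_num) (by norm_num)

theorem antitone_scale : Antitone scale := antitone_nat_of_succ_le fun k => by
  rw [scale_succ]; linarith [scale_pos k]

/-- The conductance of the `k`-th edge in the series network approaching `ζ` along the scales `4⁻ᵏ`;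
the summand `1` is the contribution of the `L²` part of the norm. -/
def conductance (μ : Measure Disc) (ζ : Circle) (k : ℕ) : ℝ≥0∞ :=
  ENNReal.ofReal (scale k) * (∫⁻ w, truncatedPoisson ζ (scale k) w ∂μ + 1)

theorem conductance_ne_zero (μ : Measure Disc) (ζ : Circle) (k : ℕ) : conductance μ ζ k ≠ 0 :=
  mul_ne_zero (by simpa using scale_pos k) (by simp)

theorem conductance_ne_top {μ : Measure Disc} (hμ : RieszFinite μ) (ζ : Circle) (k : ℕ) :
    conductance μ ζ k ≠ ∞ :=
  ENNReal.mul_ne_top ENNReal.ofReal_ne_top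
    (ENNReal.add_ne_top.2
      ⟨(lintegral_truncatedPoisson_lt_top hμ ζ (scale_pos k)).ne, ENNReal.one_ne_top⟩)

/-- The denominator `t V_μ((1 - t)ζ) + t²` of the integral criterion, in terms of `t = 1 - r`. -/
def radialWeight (μ : Measure Disc) (ζ : Circle) (t : ℝ) : ℝ≥0∞ :=
  ENNReal.ofReal t * V μ (radialPoint ζ t) + ENNReal.ofReal (t ^ 2)

theorem V_radialPoint (μ : Measure Disc) (ζ : Circle) {t : ℝ} (ht : t ≤ 1) :
    V μ (radialPoint ζ t) = ∫⁻ w : Disc, ENNReal.ofReal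
      (t * (2 - t) * ((1 - ‖(w : ℂ)‖ ^ 2) / ‖1 - conj (radialPoint ζ t) * w‖ ^ 2)) ∂μ := by
  refine lintegral_congr fun w => ?_
  rw [norm_radialPoint ζ ht, ← Complex.norm_conj (1 - _ * conj (w : ℂ)), map_sub, map_mul,
    Complex.conj_conj, map_one]
  ring_nf

section Discretization

variable (μ : Measure Disc) (ζ : Circle) {k : ℕ} {t : ℝ}

theorem conductance_le_radialWeight (hmin : scale (k + 1) ≤ t) (hmax : t ≤ scale k) :
    ENNReal.ofReal (scale k / 16) * conductance μ ζ k ≤ radialWeight μ ζ t := by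
  have hc := scale_pos k
  have hc1 := scale_le_one k
  rw [scale_succ] at hmin
  have ht : 0 < t := by linarith
  rw [conductance, ← mul_assoc, ← ENNReal.ofReal_mul (by positivity), mul_add, mul_one,
    radialWeight, V_radialPoint μ ζ (hmax.trans hc1),
    ← lintegral_const_mul' _ _ ENNReal.ofReal_ne_top,
    ← lintegral_const_mul' _ _ ENNReal.ofReal_ne_top]
  refine add_le_add (lintegral_mono fun w => ?_) (ENNReal.ofReal_le_ofReal (by nlinarith))
  rw [truncatedPoisson, ← ENNReal.ofReal_mul (by positivity), ← ENNReal.ofReal_mul ht.le]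
  refine ENNReal.ofReal_le_ofReal ?_
  have hw := (norm_disc_lt_one w).le
  have hlower := add_norm_sub_le_three_mul ζ ht.le (hmax.trans hc1) hw
  have hupper := norm_one_sub_conj_radialPoint_mul_le ζ ht.le hw
  have hδ := norm_nonneg ((ζ : ℂ) - w)
  have hcoeff : scale k / 16 * scale k ≤ t * (t * (2 - t)) :=
    calc scale k / 16 * scale k = (scale k / 4) ^ 2 := by ring
      _ ≤ t ^ 2 := by gcongr
      _ ≤ t ^ 2 * (2 - t) := le_mul_of_one_le_right (by positivity) (by linarith)
      _ = t * (t * (2 - t)) := by ring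
  have := (one_sub_norm_sq_pos w).le
  rw [← mul_assoc]
  gcongr
  · exact (by positivity : 0 ≤ scale k / 16 * scale k).trans hcoeff
  · exact pow_pos (by linarith) 2
  · linarith

theorem radialWeight_le_conductance (hmin : scale (k + 1) ≤ t) (hmax : t ≤ scale k) :
    radialWeight μ ζ t ≤ ENNReal.ofReal (288 * scale k) * conductance μ ζ k := by
  have hc := scale_pos k
  have hc1 := scale_le_one k
  rw [scale_succ] at hmin
  have ht : 0 < t := by linarith
  rw [conductance, ← mul_assoc, ← ENNReal.ofReal_mul (by positivity), mul_add, mul_one,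
    radialWeight, V_radialPoint μ ζ (hmax.trans hc1),
    ← lintegral_const_mul' _ _ ENNReal.ofReal_ne_top,
    ← lintegral_const_mul' _ _ ENNReal.ofReal_ne_top]
  refine add_le_add (lintegral_mono fun w => ?_) (ENNReal.ofReal_le_ofReal (by nlinarith))
  rw [truncatedPoisson, ← ENNReal.ofReal_mul ht.le, ← ENNReal.ofReal_mul (by positivity)]
  refine ENNReal.ofReal_le_ofReal ?_
  have hδ := norm_nonneg ((ζ : ℂ) - w)
  have hlower : (scale k + ‖(ζ : ℂ) - w‖) / 12 ≤ ‖1 - conj (radialPoint ζ t) * w‖ := by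
    linarith [add_norm_sub_le_three_mul ζ ht.le (hmax.trans hc1) (norm_disc_lt_one w).le]
  have hcoeff : t * (t * (2 - t)) ≤ scale k * (scale k * 2) := by
    gcongr
    · nlinarith
    · linarith
    · linarith
  have := (one_sub_norm_sq_pos w).le
  calc t * (t * (2 - t) * ((1 - ‖(w : ℂ)‖ ^ 2) / ‖1 - conj (radialPoint ζ t) * w‖ ^ 2))
      = t * (t * (2 - t)) * ((1 - ‖(w : ℂ)‖ ^ 2) / ‖1 - conj (radialPoint ζ t) * w‖ ^ 2) := by ring
    _ ≤ scale k * (scale k * 2) * ((1 - ‖(w : ℂ)‖ ^ 2) / ((scale k + ‖(ζ : ℂ) - w‖) / 12) ^ 2) := by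
        gcongr
    _ = 288 * scale k * scale k * ((1 - ‖(w : ℂ)‖ ^ 2) / (scale k + ‖(ζ : ℂ) - w‖) ^ 2) := by
        field_simp
        ring

theorem lintegral_Ioo_zero_one_eq_tsum_scale (g : ℝ → ℝ≥0∞) :
    ∫⁻ r in Ioo (0 : ℝ) 1, g r =
      ∑' k, ∫⁻ r in Ico (1 - scale k) (1 - scale (k + 1)), g r := by
  have hmono : Monotone fun k => 1 - scale k := fun _ _ h => sub_le_sub_left (antitone_scale h) 1
  have hdisj : Pairwise (Disjoint on fun k => Ico (1 - scale k) (1 - scale (k + 1))) :=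
    hmono.pairwise_disjoint_on_Ico_succ
  rw [← lintegral_iUnion (fun _ => measurableSet_Ico) hdisj, setLIntegral_congr Ioo_ae_eq_Ico]
  congr 2
  ext r
  simp only [mem_Ico, mem_iUnion]
  constructor
  · rintro ⟨h0, h1⟩
    obtain ⟨n, hn, hn'⟩ := exists_nat_pow_near_of_lt_one (x := 1 - r) (y := 1 / 4) (by linarith)
      (by linarith) (by norm_num) (by norm_num)
    refine ⟨n, ?_, ?_⟩ <;> unfold scale <;> linarith
  · rintro ⟨k, h0, h1⟩
    exact ⟨by linarith [scale_le_one k], by linarith [scale_pos (k + 1)]⟩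

theorem setLIntegral_annulus_inv_const (k : ℕ) {a : ℝ} (ha : 0 < a) (x : ℝ≥0∞) :
    ∫⁻ _ in Ico (1 - scale k) (1 - scale (k + 1)), (ENNReal.ofReal (a * scale k) * x)⁻¹ =
      ENNReal.ofReal (3 / (4 * a)) * x⁻¹ := by
  have hc := scale_pos k
  have has : 0 < a * scale k := by positivity
  rw [setLIntegral_const, Real.volume_Ico, scale_succ,
    ENNReal.mul_inv (Or.inl (by simpa using has)) (Or.inl ENNReal.ofReal_ne_top),
    ← ENNReal.ofReal_inv_of_pos has, mul_right_comm, ← ENNReal.ofReal_mul (by positivity)]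
  congr 2
  field_simp
  ring

theorem setLIntegral_inv_radialWeight_le (k : ℕ) :
    ∫⁻ r in Ico (1 - scale k) (1 - scale (k + 1)), (radialWeight μ ζ (1 - r))⁻¹ ≤
      ENNReal.ofReal 12 * (conductance μ ζ k)⁻¹ := by
  calc ∫⁻ r in Ico (1 - scale k) (1 - scale (k + 1)), (radialWeight μ ζ (1 - r))⁻¹
      ≤ ∫⁻ _ in Ico (1 - scale k) (1 - scale (k + 1)),
          (ENNReal.ofReal (1 / 16 * scale k) * conductance μ ζ k)⁻¹ := by
        refine setLIntegral_mono' measurableSet_Ico fun r hr => ENNReal.inv_le_inv.2 ?_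
        rw [one_div_mul_eq_div]
        exact conductance_le_radialWeight μ ζ (by linarith [hr.2]) (by linarith [hr.1])
    _ = ENNReal.ofReal 12 * (conductance μ ζ k)⁻¹ := by
        rw [setLIntegral_annulus_inv_const k (by norm_num)]
        norm_num

theorem inv_conductance_le_setLIntegral (k : ℕ) :
    (conductance μ ζ k)⁻¹ ≤ ENNReal.ofReal 384 *
      ∫⁻ r in Ico (1 - scale k) (1 - scale (k + 1)), (radialWeight μ ζ (1 - r))⁻¹ := by
  calc (conductance μ ζ k)⁻¹
      = ENNReal.ofReal 384 * ∫⁻ _ in Ico (1 - scale k) (1 - scale (k + 1)),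
          (ENNReal.ofReal (288 * scale k) * conductance μ ζ k)⁻¹ := by
        rw [setLIntegral_annulus_inv_const k (by norm_num), ← mul_assoc,
          ← ENNReal.ofReal_mul (by norm_num)]
        norm_num
    _ ≤ _ := by
        gcongr ENNReal.ofReal 384 * ?_
        refine setLIntegral_mono' measurableSet_Ico fun r hr => ENNReal.inv_le_inv.2 ?_
        exact radialWeight_le_conductance μ ζ (by linarith [hr.2]) (by linarith [hr.1])

theorem tsum_eq_top_of_le_mul {x y : ℕ → ℝ≥0∞} {a : ℝ≥0∞} (ha : a ≠ ∞)
    (hxy : ∀ k, x k ≤ a * y k) (hx : ∑' k, x k = ∞) : ∑' k, y k = ∞ := by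
  have h := ENNReal.tsum_le_tsum hxy
  rw [hx, ENNReal.tsum_mul_left, top_le_iff] at h
  exact of_not_not fun hy => ENNReal.mul_ne_top ha hy h

theorem lintegral_inv_radialWeight_eq_top_iff :
    ∫⁻ r in Ioo (0 : ℝ) 1, (radialWeight μ ζ (1 - r))⁻¹ = ∞ ↔
      ∑' k, (conductance μ ζ k)⁻¹ = ∞ := by
  rw [lintegral_Ioo_zero_one_eq_tsum_scale]
  exact ⟨tsum_eq_top_of_le_mul ENNReal.ofReal_ne_top (setLIntegral_inv_radialWeight_le μ ζ),
    tsum_eq_top_of_le_mul ENNReal.ofReal_ne_top (inv_conductance_le_setLIntegral μ ζ)⟩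

end Discretization

/-! ### The lower bound for the capacity -/

section Telescoping

variable {E : Type*} [SeminormedAddCommGroup E]

theorem enorm_sub_sq_le (x y c : E) :
    ‖x - y‖ₑ ^ 2 ≤ 2 * (‖x - c‖ₑ ^ 2 + ‖y - c‖ₑ ^ 2) := by
  have htri : ‖x - y‖₊ ≤ ‖x - c‖₊ + ‖y - c‖₊ := by
    simpa only [nndist_eq_nnnorm] using nndist_triangle_right x y c
  have hsq : ‖x - y‖₊ ^ 2 ≤ 2 * (‖x - c‖₊ ^ 2 + ‖y - c‖₊ ^ 2) :=
    (pow_le_pow_left' htri 2).trans add_sq_le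
  simp only [enorm_eq_nnnorm]
  exact_mod_cast hsq

theorem enorm_sq_le_sum_inv_mul_sum (x : ℕ → E) {C : ℕ → ℝ≥0∞} (hC0 : ∀ k, C k ≠ 0)
    (hCtop : ∀ k, C k ≠ ∞) (N : ℕ) :
    ‖x N‖ₑ ^ 2 ≤ 2 * (‖x 0‖ₑ ^ 2 + (∑ k ∈ Finset.range N, (C k)⁻¹) *
      ∑ k ∈ Finset.range N, C k * ‖x k - x (k + 1)‖ₑ ^ 2) := by
  lift C to ℕ → ℝ≥0 using hCtop
  have hC : ∀ k, C k ≠ 0 := fun k => ENNReal.coe_ne_zero.1 (hC0 k)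
  have htele : ‖x N‖₊ ≤ ‖x 0‖₊ + ∑ k ∈ Finset.range N, ‖x k - x (k + 1)‖₊ := by
    have hdist : ‖x 0 - x N‖₊ ≤ ∑ k ∈ Finset.range N, ‖x k - x (k + 1)‖₊ := by
      simp only [← nndist_eq_nnnorm, ← NNReal.coe_le_coe, NNReal.coe_sum, coe_nndist]
      exact dist_le_range_sum_dist x N
    exact (nnnorm_le_insert (x 0) (x N)).trans (by gcongr)
  have hCS := Finset.sum_sq_le_sum_mul_sum_of_sq_le_mul (Finset.range N)
    (r := fun k => ‖x k - x (k + 1)‖₊) (f := fun k => (C k)⁻¹)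
    (g := fun k => C k * ‖x k - x (k + 1)‖₊ ^ 2) (fun _ _ => zero_le) (fun _ _ => zero_le)
    (fun k _ => by rw [inv_mul_cancel_left₀ (hC k)])
  have hsq : ‖x N‖₊ ^ 2 ≤ 2 * (‖x 0‖₊ ^ 2 + (∑ k ∈ Finset.range N, (C k)⁻¹) *
      ∑ k ∈ Finset.range N, C k * ‖x k - x (k + 1)‖₊ ^ 2) :=
    calc ‖x N‖₊ ^ 2 ≤ (‖x 0‖₊ + ∑ k ∈ Finset.range N, ‖x k - x (k + 1)‖₊) ^ 2 :=
          pow_le_pow_left' htele 2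
      _ ≤ 2 * (‖x 0‖₊ ^ 2 + (∑ k ∈ Finset.range N, ‖x k - x (k + 1)‖₊) ^ 2) := add_sq_le
      _ ≤ _ := by gcongr
  simp only [enorm_eq_nnnorm, ← ENNReal.coe_inv (hC _)]
  exact_mod_cast hsq

end Telescoping

theorem ofReal_mul_setLIntegral_Ioc_comp_mul_right (g : ℝ → ℝ≥0∞) {c : ℝ} (hc : 0 < c) (a b : ℝ) :
    ENNReal.ofReal c * ∫⁻ θ in Ioc a b, g (θ * c) = ∫⁻ θ in Ioc (a * c) (b * c), g θ := by
  rw [← image_mul_right_Ioc a b hc,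
    lintegral_image_eq_lintegral_abs_deriv_mul (f' := fun _ => c) measurableSet_Ioc
      (fun x _ => by simpa using ((hasDerivAt_id x).mul_const c).hasDerivWithinAt)
      (mul_left_injective₀ hc.ne').injOn,
    lintegral_const_mul' _ _ ENNReal.ofReal_ne_top, abs_of_pos hc]

theorem sum_setLIntegral_annulus_le (g : ℝ → ℝ≥0∞) (N : ℕ) :
    ∑ k ∈ Finset.range N, ∫⁻ θ in Ioc (scale (k + 1)) (scale k), g θ ≤
      ∫⁻ θ in Ioc (0 : ℝ) 1, g θ := by
  have hdisj : Pairwise (Disjoint on fun k => Ioc (scale (k + 1)) (scale k)) :=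
    antitone_scale.pairwise_disjoint_on_Ioc_succ
  calc ∑ k ∈ Finset.range N, ∫⁻ θ in Ioc (scale (k + 1)) (scale k), g θ
      ≤ ∑' k, ∫⁻ θ in Ioc (scale (k + 1)) (scale k), g θ := ENNReal.sum_le_tsum _
    _ = ∫⁻ θ in ⋃ k, Ioc (scale (k + 1)) (scale k), g θ :=
        (lintegral_iUnion (fun _ => measurableSet_Ioc) hdisj _).symm
    _ ≤ _ := lintegral_mono_set (iUnion_subset fun k =>
        Ioc_subset_Ioc (scale_pos _).le (scale_le_one k))

section Increments

variable {h : ℝ → ℂ}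

/-- The mean square increment of `h` from the `k`-th annulus `(4⁻ᵏ⁻¹, 4⁻ᵏ]` to the next one,
the two being compared by scaling. -/
def sqIncrement (h : ℝ → ℂ) (k : ℕ) : ℝ≥0∞ :=
  ∫⁻ θ in Ioc (1 / 4 : ℝ) 1, ‖h (θ * scale k) - h (θ * scale (k + 1))‖ₑ ^ 2

theorem sqIncrement_le (hh : Measurable h) (c : ℂ) (k : ℕ) :
    ENNReal.ofReal (scale k) * sqIncrement h k ≤
      2 * (∫⁻ θ in Ioc (scale (k + 1)) (scale k), ‖h θ - c‖ₑ ^ 2) +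
        8 * ∫⁻ θ in Ioc (scale (k + 2)) (scale (k + 1)), ‖h θ - c‖ₑ ^ 2 := by
  let X : ℕ → ℝ≥0∞ := fun j => ∫⁻ θ in Ioc (1 / 4 : ℝ) 1, ‖h (θ * scale j) - c‖ₑ ^ 2
  have hX : ∀ j, ENNReal.ofReal (scale j) * X j =
      ∫⁻ θ in Ioc (scale (j + 1)) (scale j), ‖h θ - c‖ₑ ^ 2 := fun j => by
    rw [ofReal_mul_setLIntegral_Ioc_comp_mul_right (fun θ => ‖h θ - c‖ₑ ^ 2) (scale_pos j), one_mul,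
      one_div_mul_eq_div, ← scale_succ]
  have hinc : sqIncrement h k ≤ 2 * (X k + X (k + 1)) := by
    rw [← lintegral_add_left (by fun_prop), ← lintegral_const_mul _ (by fun_prop)]
    exact lintegral_mono fun θ => enorm_sub_sq_le _ _ _
  have hscale : ENNReal.ofReal (scale k) = 4 * ENNReal.ofReal (scale (k + 1)) := by
    rw [scale_succ, ← ENNReal.ofReal_ofNat 4, ← ENNReal.ofReal_mul (by norm_num),
      mul_div_cancel₀ _ (by norm_num)]
  calc ENNReal.ofReal (scale k) * sqIncrement h k
      ≤ ENNReal.ofReal (scale k) * (2 * (X k + X (k + 1))) := by gcongr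
    _ = 2 * (ENNReal.ofReal (scale k) * X k) + 2 * (ENNReal.ofReal (scale k) * X (k + 1)) := by
        ring
    _ = 2 * (ENNReal.ofReal (scale k) * X k) +
          8 * (ENNReal.ofReal (scale (k + 1)) * X (k + 1)) := by
        nth_rewrite 2 [hscale]; ring
    _ = _ := by rw [hX, hX]

theorem sum_mul_sqIncrement_le (hh : Measurable h) (c : ℂ) {Q : ℝ → ℝ≥0∞} {q : ℕ → ℝ≥0∞}
    (hq : ∀ k, ∀ θ ∈ Ioc 0 (scale k), q k ≤ Q θ) (N : ℕ) :
    ∑ k ∈ Finset.range N, ENNReal.ofReal (scale k) * q k * sqIncrement h k ≤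
      10 * ∫⁻ θ in Ioc (0 : ℝ) 1, ‖h θ - c‖ₑ ^ 2 * Q θ := by
  let J : ℕ → ℝ≥0∞ := fun j => ∫⁻ θ in Ioc (scale (j + 1)) (scale j), ‖h θ - c‖ₑ ^ 2
  let I : ℕ → ℝ≥0∞ := fun j => ∫⁻ θ in Ioc (scale (j + 1)) (scale j), ‖h θ - c‖ₑ ^ 2 * Q θ
  have hI : ∀ k j, k ≤ j → q k * J j ≤ I j := fun k j hkj => by
    rw [← lintegral_const_mul _ (by fun_prop)]
    refine setLIntegral_mono' measurableSet_Ioc fun θ hθ => ?_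
    rw [mul_comm]
    gcongr
    exact hq k θ ⟨(scale_pos _).trans hθ.1, hθ.2.trans (antitone_scale hkj)⟩
  have hterm : ∀ k, ENNReal.ofReal (scale k) * q k * sqIncrement h k ≤ 2 * I k + 8 * I (k + 1) :=
    fun k => by
    calc ENNReal.ofReal (scale k) * q k * sqIncrement h k
        = q k * (ENNReal.ofReal (scale k) * sqIncrement h k) := by ring
      _ ≤ q k * (2 * J k + 8 * J (k + 1)) := by gcongr; exact sqIncrement_le hh c k
      _ = 2 * (q k * J k) + 8 * (q k * J (k + 1)) := by ring
      _ ≤ 2 * I k + 8 * I (k + 1) := by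
          gcongr
          exacts [hI k k le_rfl, hI k (k + 1) k.le_succ]
  calc ∑ k ∈ Finset.range N, ENNReal.ofReal (scale k) * q k * sqIncrement h k
      ≤ ∑ k ∈ Finset.range N, (2 * I k + 8 * I (k + 1)) := Finset.sum_le_sum fun k _ => hterm k
    _ = 2 * ∑ k ∈ Finset.range N, I k + 8 * ∑ k ∈ Finset.range N, I (k + 1) := by
        rw [Finset.sum_add_distrib, Finset.mul_sum, Finset.mul_sum]
    _ ≤ 2 * (∫⁻ θ in Ioc (0 : ℝ) 1, ‖h θ - c‖ₑ ^ 2 * Q θ) +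
          8 * ∫⁻ θ in Ioc (0 : ℝ) 1, ‖h θ - c‖ₑ ^ 2 * Q θ := by
        gcongr
        · exact sum_setLIntegral_annulus_le _ N
        · refine le_trans ?_ (sum_setLIntegral_annulus_le _ (N + 1))
          rw [Finset.sum_range_succ']
          exact le_self_add
    _ = 10 * ∫⁻ θ in Ioc (0 : ℝ) 1, ‖h θ - c‖ₑ ^ 2 * Q θ := by ring

end Increments

theorem norm_mul_exp_sub_le (ζ : Circle) (θ : ℝ) :
    ‖((ζ * Circle.exp θ : Circle) : ℂ) - ζ‖ ≤ |θ| := by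
  calc ‖((ζ * Circle.exp θ : Circle) : ℂ) - ζ‖
      = ‖(ζ : ℂ) * (Complex.exp (Complex.I * θ) - 1)‖ := by
        rw [Circle.coe_mul, Circle.coe_exp, mul_comm Complex.I, mul_sub, mul_one]
    _ ≤ |θ| := by
        rw [norm_mul, Circle.norm_coe, one_mul]
        exact Real.norm_exp_I_mul_ofReal_sub_one_le

theorem truncatedPoisson_le_poissonKernel (ζ : Circle) {t θ : ℝ} (hθ : |θ| ≤ t) (w : Disc) :
    truncatedPoisson ζ t w ≤ ENNReal.ofReal (poissonKernel 0 w (ζ * Circle.exp θ : Circle)) := by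
  rw [poissonKernel_zero_circle]
  refine ENNReal.ofReal_le_ofReal ?_
  have hdist : ‖((ζ * Circle.exp θ : Circle) : ℂ) - w‖ ≤ t + ‖(ζ : ℂ) - w‖ := by
    linarith [norm_sub_le_norm_sub_add_norm_sub ((ζ * Circle.exp θ : Circle) : ℂ) ζ (w : ℂ),
      norm_mul_exp_sub_le ζ θ]
  have hpos := norm_pos_iff.2 (circle_sub_ne_zero (ζ * Circle.exp θ) (norm_disc_lt_one w))
  have := (one_sub_norm_sq_pos w).le
  gcongr

section LowerBound

variable {μ : Measure Disc} (ζ : Circle) {F : Circle → ℂ} (hF : Measurable F) (N : ℕ)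

include hF

theorem sum_mul_sqIncrement_circle_le (c : ℂ) {Q : Circle → ℝ≥0∞} (hQ : Measurable Q)
    {q : ℕ → ℝ≥0∞} (hq : ∀ k, ∀ θ ∈ Ioc 0 (scale k), q k ≤ Q (ζ * Circle.exp θ)) :
    ∑ k ∈ Finset.range N,
        ENNReal.ofReal (scale k) * q k * sqIncrement (fun θ => F (ζ * Circle.exp θ)) k ≤
      10 * (ENNReal.ofReal (2 * Real.pi) * ∫⁻ ξ, ‖F ξ - c‖ₑ ^ 2 * Q ξ ∂circleMeasure) := by
  have hexp : Measurable fun θ : ℝ => Circle.exp θ := Circle.exp.continuous.measurable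
  refine (sum_mul_sqIncrement_le (by fun_prop) c hq N).trans ?_
  gcongr
  exact setLIntegral_mul_exp_le ζ (G := fun ξ => ‖F ξ - c‖ₑ ^ 2 * Q ξ) (by fun_prop)

theorem sum_truncatedPoisson_mul_sqIncrement_le (w : Disc) :
    ∑ k ∈ Finset.range N, ENNReal.ofReal (scale k) * truncatedPoisson ζ (scale k) w *
        sqIncrement (fun θ => F (ζ * Circle.exp θ)) k ≤
      10 * (ENNReal.ofReal (2 * Real.pi) *
        ∫⁻ ξ, ∫⁻ η, ‖F η - F ξ‖ₑ ^ 2 ∂harmonicMeasure w ∂harmonicMeasure w) := by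
  have hP : Measurable fun ξ : Circle => ENNReal.ofReal (poissonKernel 0 w ξ) :=
    (continuous_poissonKernel (norm_disc_lt_one w)).measurable.ennreal_ofReal
  have hbound : ∀ c : ℂ, ∑ k ∈ Finset.range N,
      ENNReal.ofReal (scale k) * truncatedPoisson ζ (scale k) w *
        sqIncrement (fun θ => F (ζ * Circle.exp θ)) k ≤ 10 * (ENNReal.ofReal (2 * Real.pi) *
      ∫⁻ η, ‖F η - c‖ₑ ^ 2 ∂harmonicMeasure w) := fun c => by
    rw [lintegral_harmonicMeasure]
    exact sum_mul_sqIncrement_circle_le ζ hF N c hP fun k θ hθ =>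
      truncatedPoisson_le_poissonKernel ζ (abs_le.2 ⟨by linarith [hθ.1, scale_pos k], hθ.2⟩) w
  rw [← lintegral_const_mul' _ _ ENNReal.ofReal_ne_top, ← lintegral_const_mul' _ _ (by simp)]
  refine le_trans (le_of_eq ?_) (lintegral_mono fun ξ => hbound (F ξ))
  rw [lintegral_const, measure_univ, mul_one]

theorem sum_conductance_mul_sqIncrement_le [SFinite μ] :
    ∑ k ∈ Finset.range N,
        conductance μ ζ k * sqIncrement (fun θ => F (ζ * Circle.exp θ)) k ≤
      10 * (ENNReal.ofReal (2 * Real.pi) * normSq μ F) := by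
  have hL2 : ∑ k ∈ Finset.range N,
      ENNReal.ofReal (scale k) * sqIncrement (fun θ => F (ζ * Circle.exp θ)) k ≤
      10 * (ENNReal.ofReal (2 * Real.pi) * ∫⁻ ξ, ‖F ξ‖ₑ ^ 2 ∂circleMeasure) := by
    simpa using sum_mul_sqIncrement_circle_le ζ hF N 0 (Q := fun _ => 1) measurable_const
      (q := fun _ => 1) fun _ _ _ => le_rfl
  have henergy : ∑ k ∈ Finset.range N, ENNReal.ofReal (scale k) *
      (∫⁻ w, truncatedPoisson ζ (scale k) w ∂μ) * sqIncrement (fun θ => F (ζ * Circle.exp θ)) k ≤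
      10 * (ENNReal.ofReal (2 * Real.pi) * energy μ F) := by
    have hT := fun k => measurable_truncatedPoisson ζ (scale k)
    rw [energy_eq_lintegral_harmonicMeasure hF, ← lintegral_const_mul' _ _ ENNReal.ofReal_ne_top,
      ← lintegral_const_mul' _ _ (by simp)]
    refine le_trans (le_of_eq ?_)
      (lintegral_mono fun w => sum_truncatedPoisson_mul_sqIncrement_le ζ hF N w)
    rw [lintegral_finsetSum _ fun k _ => ((hT k).const_mul _).mul_const _]
    refine Finset.sum_congr rfl fun k _ => ?_
    rw [lintegral_mul_const _ ((hT k).const_mul _), lintegral_const_mul _ (hT k)]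
  calc ∑ k ∈ Finset.range N, conductance μ ζ k * sqIncrement (fun θ => F (ζ * Circle.exp θ)) k
      = ∑ k ∈ Finset.range N, ENNReal.ofReal (scale k) *
            (∫⁻ w, truncatedPoisson ζ (scale k) w ∂μ) *
              sqIncrement (fun θ => F (ζ * Circle.exp θ)) k +
          ∑ k ∈ Finset.range N,
            ENNReal.ofReal (scale k) * sqIncrement (fun θ => F (ζ * Circle.exp θ)) k := by
        simp only [conductance, mul_add, mul_one, add_mul, Finset.sum_add_distrib]
    _ ≤ 10 * (ENNReal.ofReal (2 * Real.pi) * energy μ F) +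
          10 * (ENNReal.ofReal (2 * Real.pi) * ∫⁻ ξ, ‖F ξ‖ₑ ^ 2 ∂circleMeasure) :=
        add_le_add henergy hL2
    _ = 10 * (ENNReal.ofReal (2 * Real.pi) * normSq μ F) := by rw [normSq]; ring

end LowerBound

theorem exists_mul_exp_mul_scale_mem {U : Set Circle} (hU : IsOpen U) {ζ : Circle} (hζ : ζ ∈ U) :
    ∃ N, ∀ θ ∈ Ioc (1 / 4 : ℝ) 1, ζ * Circle.exp (θ * scale N) ∈ U := by
  obtain ⟨ε, hε, hball⟩ := Metric.isOpen_iff.1 hU ζ hζ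
  obtain ⟨N, hN⟩ := exists_pow_lt_of_lt_one hε (by norm_num : (1 / 4 : ℝ) < 1)
  refine ⟨N, fun θ hθ => hball ?_⟩
  have hs := scale_pos N
  have hθ0 : 0 ≤ θ := by linarith [hθ.1]
  calc dist ((ζ * Circle.exp (θ * scale N) : Circle) : ℂ) ζ
      ≤ |θ * scale N| := by rw [dist_eq_norm]; exact norm_mul_exp_sub_le ζ _
    _ ≤ scale N := by
        rw [abs_of_nonneg (by positivity)]
        exact mul_le_of_le_one_left hs.le hθ.2
    _ < ε := hN

theorem three_quarters_le_mul_normSq {μ : Measure Disc} (hμ : RieszFinite μ) {ζ : Circle}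
    {F : Circle → ℂ} (hF : Measurable F) {U : Set Circle} (hU : IsOpen U) (hζ : ζ ∈ U)
    (hFU : ∀ ξ ∈ U, 1 ≤ ‖F ξ‖) :
    ENNReal.ofReal (3 / 4) ≤ 2 * ENNReal.ofReal (2 * Real.pi) *
      (1 + 10 * ∑' k, (conductance μ ζ k)⁻¹) * normSq μ F := by
  have := hμ.sigmaFinite
  have hexp : Measurable fun θ : ℝ => Circle.exp θ := Circle.exp.continuous.measurable
  obtain ⟨N, hN⟩ := exists_mul_exp_mul_scale_mem hU hζ
  let x : ℝ → ℕ → ℂ := fun θ k => F (ζ * Circle.exp (θ * scale k))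
  have : ∀ k, Measurable fun θ => x θ k := fun k => by fun_prop
  have hx0 : ∫⁻ θ in Ioc (1 / 4 : ℝ) 1, ‖x θ 0‖ₑ ^ 2 ≤
      ENNReal.ofReal (2 * Real.pi) * normSq μ F := by
    simp only [x, scale_zero, mul_one]
    calc ∫⁻ θ in Ioc (1 / 4 : ℝ) 1, ‖F (ζ * Circle.exp θ)‖ₑ ^ 2
        ≤ ∫⁻ θ in Ioc (0 : ℝ) 1, ‖F (ζ * Circle.exp θ)‖ₑ ^ 2 :=
          lintegral_mono_set (Ioc_subset_Ioc (by norm_num) le_rfl)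
      _ ≤ ENNReal.ofReal (2 * Real.pi) * ∫⁻ ξ, ‖F ξ‖ₑ ^ 2 ∂circleMeasure :=
          setLIntegral_mul_exp_le ζ (G := fun ξ => ‖F ξ‖ₑ ^ 2) (by fun_prop)
      _ ≤ _ := by gcongr; exact le_self_add
  set R := ∑ k ∈ Finset.range N, (conductance μ ζ k)⁻¹
  calc ENNReal.ofReal (3 / 4) = ∫⁻ _ in Ioc (1 / 4 : ℝ) 1, (1 : ℝ≥0∞) := by
        rw [setLIntegral_const, one_mul, Real.volume_Ioc]; norm_num
    _ ≤ ∫⁻ θ in Ioc (1 / 4 : ℝ) 1, 2 * (‖x θ 0‖ₑ ^ 2 +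
          R * ∑ k ∈ Finset.range N, conductance μ ζ k * ‖x θ k - x θ (k + 1)‖ₑ ^ 2) :=
        setLIntegral_mono' measurableSet_Ioc fun θ hθ =>
          (one_le_pow₀ (ENNReal.one_le_coe_iff.2 (hFU _ (hN θ hθ)))).trans
            (enorm_sq_le_sum_inv_mul_sum (x θ) (conductance_ne_zero μ ζ)
              (conductance_ne_top hμ ζ) N)
    _ = 2 * ((∫⁻ θ in Ioc (1 / 4 : ℝ) 1, ‖x θ 0‖ₑ ^ 2) + R * ∑ k ∈ Finset.range N,
          conductance μ ζ k * sqIncrement (fun θ => F (ζ * Circle.exp θ)) k) := by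
        rw [lintegral_const_mul _ (by fun_prop), lintegral_add_left (by fun_prop),
          lintegral_const_mul _ (by fun_prop), lintegral_finsetSum _ fun k _ => by fun_prop]
        simp only [sqIncrement, lintegral_const_mul' _ _ (conductance_ne_top hμ ζ _), x]
    _ ≤ 2 * (ENNReal.ofReal (2 * Real.pi) * normSq μ F +
          (∑' k, (conductance μ ζ k)⁻¹) * (10 * (ENNReal.ofReal (2 * Real.pi) * normSq μ F))) := by
        gcongr
        exacts [ENNReal.sum_le_tsum _, sum_conductance_mul_sqIncrement_le ζ hF N]
    _ = _ := by ring

theorem normSq_congr_ae (μ : Measure Disc) {f g : Circle → ℂ} (h : f =ᵐ[circleMeasure] g) :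
    normSq μ f = normSq μ g := by
  rw [normSq, normSq, energy, energy]
  congr 1
  · exact lintegral_congr_ae (h.mono fun ξ hξ => by simp only [hξ])
  · refine lintegral_congr_ae (h.mono fun ξ hξ => ?_)
    exact lintegral_congr_ae (h.mono fun η hη => by simp only [hξ, hη])

theorem exists_measurable_ae_eq_one_le_norm {X : Type*} [MeasurableSpace X] {ν : Measure X}
    {f : X → ℂ} (hf : AEMeasurable f ν) {U : Set X} (hU : MeasurableSet U)
    (hfU : ∀ᵐ x ∂ν, x ∈ U → 1 ≤ ‖f x‖) :
    ∃ F : X → ℂ, Measurable F ∧ f =ᵐ[ν] F ∧ ∀ x ∈ U, 1 ≤ ‖F x‖ := by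
  classical
  obtain ⟨g, hg, hfg⟩ := hf
  let B : Set X := U ∩ {x | ‖g x‖ < 1}
  have hB : MeasurableSet B := hU.inter (measurableSet_lt hg.norm measurable_const)
  refine ⟨B.piecewise 1 g, measurable_one.piecewise hB hg, ?_, fun x hx => ?_⟩
  · filter_upwards [hfg, hfU] with x hxg hxU
    have hxB : x ∉ B := fun hxB => hxB.2.not_ge (hxg ▸ hxU hxB.1)
    rw [piecewise_eq_of_notMem _ _ _ hxB, hxg]
  · by_cases hxB : x ∈ B
    · rw [piecewise_eq_of_mem _ _ _ hxB, Pi.one_apply, norm_one]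
    · rw [piecewise_eq_of_notMem _ _ _ hxB]
      exact not_lt.1 fun hlt => hxB ⟨hx, hlt⟩

theorem capacity_singleton_ne_zero {μ : Measure Disc} (hμ : RieszFinite μ) (ζ : Circle)
    (hR : ∑' k, (conductance μ ζ k)⁻¹ ≠ ∞) : capacity μ {ζ} ≠ 0 := by
  let K : ℝ≥0∞ := 2 * ENNReal.ofReal (2 * Real.pi) * (1 + 10 * ∑' k, (conductance μ ζ k)⁻¹)
  have hK : K ≠ ∞ := by finiteness
  have hle : ENNReal.ofReal (3 / 4) / K ≤ capacity μ {ζ} := by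
    refine le_sInf ?_
    rintro c ⟨f, hf, ⟨U, hU, hζU, hfU⟩, rfl⟩
    obtain ⟨F, hF, hfF, hFU⟩ :=
      exists_measurable_ae_eq_one_le_norm hf.1.1.aemeasurable hU.measurableSet hfU
    rw [normSq_congr_ae μ hfF]
    exact ENNReal.div_le_of_le_mul' (three_quarters_le_mul_normSq hμ hF hU (hζU rfl) hFU)
  exact fun h0 => (ENNReal.div_pos (by norm_num) hK).not_ge (h0 ▸ hle)

/-! ### The upper bound for the capacity -/

theorem sum_mul_mul_le_mul_sum_sq {ι : Type*} (s : Finset ι) (x : ι → ℝ) {K : ι → ι → ℝ} {C : ℝ}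
    (hK : ∀ i j, 0 ≤ K i j) (hsymm : ∀ i j, K i j = K j i) (hrow : ∀ i, ∑ j ∈ s, K i j ≤ C) :
    ∑ i ∈ s, ∑ j ∈ s, x i * x j * K i j ≤ C * ∑ i ∈ s, x i ^ 2 := by
  have hterm : ∀ i j, x i * x j * K i j ≤ x i ^ 2 / 2 * K i j + x j ^ 2 / 2 * K j i := fun i j => by
    rw [← hsymm i j, ← add_mul]
    exact mul_le_mul_of_nonneg_right (by linarith [two_mul_le_add_sq (x i) (x j)]) (hK i j)
  have hhalf : ∑ i ∈ s, ∑ j ∈ s, x i ^ 2 / 2 * K i j ≤ C / 2 * ∑ i ∈ s, x i ^ 2 := by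
    rw [Finset.mul_sum]
    refine Finset.sum_le_sum fun i _ => ?_
    rw [← Finset.mul_sum]
    nlinarith [mul_le_mul_of_nonneg_left (hrow i) (sq_nonneg (x i))]
  calc ∑ i ∈ s, ∑ j ∈ s, x i * x j * K i j
      ≤ ∑ i ∈ s, ∑ j ∈ s, (x i ^ 2 / 2 * K i j + x j ^ 2 / 2 * K j i) :=
        Finset.sum_le_sum fun i _ => Finset.sum_le_sum fun j _ => hterm i j
    _ = ∑ i ∈ s, ∑ j ∈ s, x i ^ 2 / 2 * K i j + ∑ i ∈ s, ∑ j ∈ s, x i ^ 2 / 2 * K i j := by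
        simp only [Finset.sum_add_distrib]
        rw [Finset.sum_comm (f := fun i j => x j ^ 2 / 2 * K j i)]
    _ ≤ C * ∑ i ∈ s, x i ^ 2 := by linarith

theorem sum_half_pow_dist_le (j N : ℕ) :
    ∑ k ∈ Finset.range N, (1 / 2 : ℝ) ^ Nat.dist j k ≤ 3 - (1 / 2) ^ j := by
  induction j generalizing N with
  | zero =>
    have hgeom := sum_geometric_two_le N
    simp only [Nat.dist_zero_left, pow_zero]
    linarith
  | succ j ih =>
    cases N with
    | zero =>
      have : (1 / 2 : ℝ) ^ (j + 1) ≤ 1 := pow_le_one₀ (by norm_num) (by norm_num)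
      rw [Finset.sum_range_zero]
      linarith
    | succ N =>
      have hN := ih N
      simp only [Finset.sum_range_succ', Nat.dist_add_add_right, Nat.dist_zero_right, pow_succ]
      linarith

theorem scale_mul_scale_div_le (j k : ℕ) :
    scale j * scale k / (1 - (1 - scale j) * (1 - scale k)) ≤
      (1 / 2) ^ j * (1 / 2) ^ k * (1 / 2) ^ Nat.dist j k := by
  wlog hjk : j ≤ k generalizing j k
  · have hkj := this k j (by omega)
    rwa [mul_comm (scale k), mul_comm (1 - scale k), mul_comm ((1 / 2 : ℝ) ^ k),
      Nat.dist_comm] at hkj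
  have hj := scale_pos j
  have hk := scale_pos k
  have hden : scale j ≤ 1 - (1 - scale j) * (1 - scale k) := by nlinarith [scale_le_one j]
  calc scale j * scale k / (1 - (1 - scale j) * (1 - scale k))
      ≤ scale j * scale k / scale j := by gcongr
    _ = (1 / 2) ^ k * (1 / 2) ^ k := by
        rw [mul_div_cancel_left₀ _ hj.ne', scale, ← mul_pow]; norm_num
    _ = (1 / 2) ^ j * (1 / 2) ^ k * (1 / 2) ^ Nat.dist j k := by
        rw [Nat.dist_eq_sub_of_le hjk, mul_right_comm, pow_mul_pow_sub _ hjk]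

theorem lintegral_enorm_sum_sq_le {X ι : Type*} [MeasurableSpace X] {ν : Measure X} (s : Finset ι)
    (a : ι → ℂ) {f : ι → X → ℂ} (hf : ∀ i, MemLp (f i) 2 ν) :
    ∫⁻ x, ‖∑ i ∈ s, a i * f i x‖ₑ ^ 2 ∂ν ≤
      ENNReal.ofReal (∑ i ∈ s, ∑ j ∈ s, ‖a i‖ * ‖a j‖ * ‖∫ x, f i x * conj (f j x) ∂ν‖) := by
  let F : X → ℂ := fun x => ∑ i ∈ s, a i * f i x
  have hpair : ∀ i j, Integrable (fun x => f i x * conj (f j x)) ν := fun i j =>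
    (hf i).integrable_mul (hf j).star
  have hF : MemLp F 2 ν := memLp_finsetSum s fun i _ => (hf i).const_mul (a i)
  have hFF : Integrable (fun x => F x * conj (F x)) ν := hF.integrable_mul hF.star
  have hexpand : ∀ x, F x * conj (F x) =
      ∑ i ∈ s, ∑ j ∈ s, a i * conj (a j) * (f i x * conj (f j x)) := fun x => by
    simp only [F, map_sum, map_mul, Finset.sum_mul_sum]
    exact Finset.sum_congr rfl fun i _ => Finset.sum_congr rfl fun j _ => by ring
  have hintegral : ∫ x, F x * conj (F x) ∂ν =
      ∑ i ∈ s, ∑ j ∈ s, a i * conj (a j) * ∫ x, f i x * conj (f j x) ∂ν := by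
    simp only [hexpand, ← integral_const_mul]
    rw [integral_finsetSum _ fun i _ => integrable_finsetSum _ fun j _ =>
      (hpair i j).const_mul _]
    exact Finset.sum_congr rfl fun i _ => integral_finsetSum _ fun j _ => (hpair i j).const_mul _
  have hnorm : ∫ x, ‖F x * conj (F x)‖ ∂ν = ‖∫ x, F x * conj (F x) ∂ν‖ := by
    have hreal : ∀ x, F x * conj (F x) = ((‖F x * conj (F x)‖ : ℝ) : ℂ) := fun x => by
      rw [Complex.mul_conj, Complex.norm_of_nonneg (Complex.normSq_nonneg _)]
    rw [integral_congr_ae (ae_of_all _ hreal), integral_complex_ofReal,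
      Complex.norm_of_nonneg (integral_nonneg fun _ => norm_nonneg _)]
  calc ∫⁻ x, ‖F x‖ₑ ^ 2 ∂ν = ENNReal.ofReal ‖∫ x, F x * conj (F x) ∂ν‖ := by
        rw [← hnorm, ofReal_integral_norm_eq_lintegral_enorm hFF]
        simp only [enorm_mul, RCLike.enorm_conj, sq]
    _ ≤ _ := ENNReal.ofReal_le_ofReal ?_
  rw [hintegral]
  refine (norm_sum_le _ _).trans (Finset.sum_le_sum fun i _ => (norm_sum_le _ _).trans
    (Finset.sum_le_sum fun j _ => le_of_eq ?_))
  rw [norm_mul, norm_mul, Complex.norm_conj]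

theorem lintegral_lintegral_enorm_sub_sq_le {X : Type*} [MeasurableSpace X] (ν : Measure X)
    [IsProbabilityMeasure ν] {f : X → ℂ} (hf : Measurable f) (c : ℂ) :
    ∫⁻ x, ∫⁻ y, ‖f y - f x‖ₑ ^ 2 ∂ν ∂ν ≤ 4 * ∫⁻ x, ‖f x - c‖ₑ ^ 2 ∂ν := by
  calc ∫⁻ x, ∫⁻ y, ‖f y - f x‖ₑ ^ 2 ∂ν ∂ν
      ≤ ∫⁻ x, ∫⁻ y, 2 * (‖f y - c‖ₑ ^ 2 + ‖f x - c‖ₑ ^ 2) ∂ν ∂ν :=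
        lintegral_mono fun _ => lintegral_mono fun _ => enorm_sub_sq_le _ _ _
    _ = ∫⁻ x, 2 * (∫⁻ y, ‖f y - c‖ₑ ^ 2 ∂ν + ‖f x - c‖ₑ ^ 2) ∂ν := by
        refine lintegral_congr fun x => ?_
        rw [lintegral_const_mul _ (by fun_prop), lintegral_add_left (by fun_prop), lintegral_const,
          measure_univ, mul_one]
    _ = 4 * ∫⁻ x, ‖f x - c‖ₑ ^ 2 ∂ν := by
        rw [lintegral_const_mul _ (by fun_prop), lintegral_add_left (by fun_prop), lintegral_const,
          measure_univ, mul_one]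
        ring

theorem szego_sub_szego {a z w : ℂ} (ha : ‖a‖ < 1) (hz : ‖z‖ ≤ 1) (hw : ‖w‖ ≤ 1) :
    szego a z - szego a w = (z - w) * (conj a * szego a w * szego a z) := by
  have hz0 := one_sub_conj_mul_ne_zero ha hz
  have hw0 := one_sub_conj_mul_ne_zero ha hw
  unfold szego
  field_simp
  ring

theorem radialPoint_zero (ζ : Circle) : radialPoint ζ 0 = ζ := by
  rw [radialPoint, sub_zero, Complex.ofReal_one, one_mul]

theorem norm_radialPoint_scale_lt_one (ζ : Circle) (k : ℕ) : ‖radialPoint ζ (scale k)‖ < 1 := by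
  rw [norm_radialPoint ζ (scale_le_one k)]
  exact sub_lt_self 1 (scale_pos k)

theorem conj_radialPoint_mul_radialPoint (ζ : Circle) (s t : ℝ) :
    conj (radialPoint ζ s) * radialPoint ζ t = ((1 - s) * (1 - t) : ℝ) := by
  have hζ : conj (ζ : ℂ) * ζ = 1 := by
    rw [mul_comm, Complex.mul_conj, Circle.normSq_coe, Complex.ofReal_one]
  rw [radialPoint, radialPoint, map_mul, Complex.conj_ofReal, mul_mul_mul_comm, hζ, mul_one,
    Complex.ofReal_mul]

theorem norm_szego_radialPoint_le (ζ : Circle) {t : ℝ} (ht : 0 < t) (ht1 : t ≤ 1) {w : ℂ}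
    (hw : ‖w‖ ≤ 1) : ‖szego (radialPoint ζ t) w‖ ≤ 3 / (t + ‖(ζ : ℂ) - w‖) := by
  have hlower := add_norm_sub_le_three_mul ζ ht.le ht1 hw
  have hpos : 0 < t + ‖(ζ : ℂ) - w‖ := by positivity
  rw [szego, norm_inv, le_div_iff₀ hpos, inv_mul_le_iff₀ (by linarith)]
  linarith

/-- The Szegő kernel at the point `(1 - 4⁻ᵏ)ζ`, normalized to take the value `1` at `ζ`. -/
def radialSzego (ζ : Circle) (k : ℕ) (z : ℂ) : ℂ :=
  scale k * szego (radialPoint ζ (scale k)) z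

theorem continuous_radialSzego (ζ : Circle) (k : ℕ) :
    Continuous fun ξ : Circle => radialSzego ζ k ξ :=
  continuous_const.mul (continuous_szego (norm_radialPoint_scale_lt_one ζ k))

theorem radialSzego_self (ζ : Circle) (k : ℕ) : radialSzego ζ k ζ = 1 := by
  have hk : (scale k : ℂ) ≠ 0 := by exact_mod_cast (scale_pos k).ne'
  have hζ := conj_radialPoint_mul_radialPoint ζ (scale k) 0
  rw [radialPoint_zero, sub_zero, mul_one] at hζ
  rw [radialSzego, szego, hζ, Complex.ofReal_sub, Complex.ofReal_one, sub_sub_cancel,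
    mul_inv_cancel₀ hk]

theorem norm_integral_radialSzego_mul_conj_le (ζ : Circle) (j k : ℕ) :
    ‖∫ ξ : Circle, radialSzego ζ j ξ * conj (radialSzego ζ k ξ) ∂circleMeasure‖ ≤
      (1 / 2) ^ j * (1 / 2) ^ k * (1 / 2) ^ Nat.dist j k := by
  have hreproducing := integral_mul_conj_szego
    (diffContOnCl_szego (norm_radialPoint_scale_lt_one ζ j)) (norm_radialPoint_scale_lt_one ζ k)
  have hden : 0 ≤ 1 - (1 - scale j) * (1 - scale k) := by
    nlinarith [scale_pos j, scale_pos k, scale_le_one j, scale_le_one k]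
  have hvalue : ∫ ξ : Circle, radialSzego ζ j ξ * conj (radialSzego ζ k ξ) ∂circleMeasure =
      ((scale j * scale k / (1 - (1 - scale j) * (1 - scale k)) : ℝ) : ℂ) := by
    simp only [radialSzego, map_mul, Complex.conj_ofReal, mul_mul_mul_comm]
    rw [integral_const_mul, hreproducing, szego, conj_radialPoint_mul_radialPoint]
    push_cast
    rw [div_eq_mul_inv]
  rw [hvalue, Complex.norm_of_nonneg
    (div_nonneg (mul_nonneg (scale_pos j).le (scale_pos k).le) hden)]
  exact scale_mul_scale_div_le j k

theorem lintegral_sum_radialSzego_le (ζ : Circle) (a : ℕ → ℂ) (N : ℕ) :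
    ∫⁻ ξ : Circle, ‖∑ k ∈ Finset.range N, a k * radialSzego ζ k ξ‖ₑ ^ 2 ∂circleMeasure ≤
      3 * ∑ k ∈ Finset.range N, ‖a k‖ₑ ^ 2 * ENNReal.ofReal (scale k) := by
  have hmem : ∀ k, MemLp (fun ξ : Circle => radialSzego ζ k ξ) 2 circleMeasure := fun k =>
    (continuous_radialSzego ζ k).memLp_of_hasCompactSupport (.of_compactSpace _)
  have hscale : ∀ k, ((1 / 2 : ℝ) ^ k) ^ 2 = scale k := fun k => by
    rw [scale, ← pow_mul, mul_comm, pow_mul]; norm_num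
  have hrow : ∀ j, ∑ k ∈ Finset.range N, (1 / 2 : ℝ) ^ Nat.dist j k ≤ 3 := fun j =>
    (sum_half_pow_dist_le j N).trans (sub_le_self 3 (by positivity))
  have hschur : ∑ j ∈ Finset.range N, ∑ k ∈ Finset.range N, ‖a j‖ * ‖a k‖ *
      ‖∫ ξ : Circle, radialSzego ζ j ξ * conj (radialSzego ζ k ξ) ∂circleMeasure‖ ≤
      3 * ∑ k ∈ Finset.range N, ‖a k‖ ^ 2 * scale k := by
    calc _ ≤ ∑ j ∈ Finset.range N, ∑ k ∈ Finset.range N,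
          (‖a j‖ * (1 / 2) ^ j) * (‖a k‖ * (1 / 2) ^ k) * (1 / 2) ^ Nat.dist j k := by
          refine Finset.sum_le_sum fun j _ => Finset.sum_le_sum fun k _ => ?_
          rw [mul_mul_mul_comm, mul_assoc (‖a j‖ * ‖a k‖)]
          gcongr
          exact norm_integral_radialSzego_mul_conj_le ζ j k
      _ ≤ 3 * ∑ k ∈ Finset.range N, (‖a k‖ * (1 / 2) ^ k) ^ 2 :=
          sum_mul_mul_le_mul_sum_sq _ _ (fun _ _ => by positivity)
            (fun j k => by rw [Nat.dist_comm]) hrow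
      _ = _ := by simp only [mul_pow, hscale]
  refine ((lintegral_enorm_sum_sq_le _ a hmem).trans (ENNReal.ofReal_le_ofReal hschur)).trans_eq ?_
  rw [ENNReal.ofReal_mul (by norm_num), ENNReal.ofReal_ofNat,
    ENNReal.ofReal_sum_of_nonneg fun k _ => mul_nonneg (sq_nonneg _) (scale_pos k).le]
  simp only [ENNReal.ofReal_mul (sq_nonneg _), ENNReal.ofReal_pow (norm_nonneg _), ofReal_norm]

/-- The test functions for the upper bound of the capacity of `{ζ}`, whose value at `ζ` is
the sum of the coefficients. -/
def szegoSum (ζ : Circle) (a : ℕ → ℂ) (N : ℕ) (z : ℂ) : ℂ :=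
  ∑ k ∈ Finset.range N, a k * radialSzego ζ k z

section UpperBound

variable (ζ : Circle) (a : ℕ → ℂ) (N : ℕ)

theorem continuous_szegoSum : Continuous fun ξ : Circle => szegoSum ζ a N ξ :=
  continuous_finsetSum _ fun k _ => continuous_const.mul (continuous_radialSzego ζ k)

theorem szegoSum_sub_szegoSum {z w : ℂ} (hz : ‖z‖ ≤ 1) (hw : ‖w‖ ≤ 1) :
    szegoSum ζ a N z - szegoSum ζ a N w = (z - w) *
      szegoSum ζ (fun k => a k *
        (conj (radialPoint ζ (scale k)) * szego (radialPoint ζ (scale k)) w)) N z := by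
  rw [szegoSum, szegoSum, szegoSum, ← Finset.sum_sub_distrib, Finset.mul_sum]
  refine Finset.sum_congr rfl fun k _ => ?_
  rw [radialSzego, radialSzego, ← mul_sub, ← mul_sub,
    szego_sub_szego (norm_radialPoint_scale_lt_one ζ k) hz hw]
  ring

theorem ofReal_one_sub_norm_sq_mul_enorm_szego_sq_le (k : ℕ) (w : Disc) :
    ENNReal.ofReal (1 - ‖(w : ℂ)‖ ^ 2) *
        ‖conj (radialPoint ζ (scale k)) * szego (radialPoint ζ (scale k)) w‖ₑ ^ 2 ≤
      9 * truncatedPoisson ζ (scale k) w := by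
  have hw := one_sub_norm_sq_pos w
  have hszego : ‖conj (radialPoint ζ (scale k)) * szego (radialPoint ζ (scale k)) w‖ ≤
      3 / (scale k + ‖(ζ : ℂ) - w‖) := by
    rw [norm_mul, Complex.norm_conj]
    exact (mul_le_of_le_one_left (norm_nonneg _) (norm_radialPoint_scale_lt_one ζ k).le).trans
      (norm_szego_radialPoint_le ζ (scale_pos k) (scale_le_one k) (norm_disc_lt_one w).le)
  rw [truncatedPoisson, ← ofReal_norm, ← ENNReal.ofReal_pow (norm_nonneg _),
    ← ENNReal.ofReal_mul hw.le, ← ENNReal.ofReal_ofNat 9, ← ENNReal.ofReal_mul (by norm_num)]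
  refine ENNReal.ofReal_le_ofReal ?_
  calc (1 - ‖(w : ℂ)‖ ^ 2) *
        ‖conj (radialPoint ζ (scale k)) * szego (radialPoint ζ (scale k)) w‖ ^ 2
      ≤ (1 - ‖(w : ℂ)‖ ^ 2) * (3 / (scale k + ‖(ζ : ℂ) - w‖)) ^ 2 := by gcongr
    _ = 9 * ((1 - ‖(w : ℂ)‖ ^ 2) / (scale k + ‖(ζ : ℂ) - w‖) ^ 2) := by
        rw [div_pow]; ring

theorem lintegral_szegoSum_sub_le (w : Disc) :
    ∫⁻ ξ : Circle, ‖szegoSum ζ a N ξ - szegoSum ζ a N w‖ₑ ^ 2 ∂harmonicMeasure w ≤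
      27 * ∑ k ∈ Finset.range N,
        ‖a k‖ₑ ^ 2 * ENNReal.ofReal (scale k) * truncatedPoisson ζ (scale k) w := by
  have := one_sub_norm_sq_pos w
  let u : ℕ → ℂ := fun k =>
    conj (radialPoint ζ (scale k)) * szego (radialPoint ζ (scale k)) w
  -- The increment of `szegoSum` has a factor `ξ - w`, which cancels the Poisson singularity.
  have hcancel : ∀ ξ : Circle, ‖szegoSum ζ a N ξ - szegoSum ζ a N w‖ₑ ^ 2 *
      ENNReal.ofReal (poissonKernel 0 w ξ) =
      ENNReal.ofReal (1 - ‖(w : ℂ)‖ ^ 2) * ‖szegoSum ζ (fun k => a k * u k) N ξ‖ₑ ^ 2 := fun ξ => by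
    have hξw := norm_pos_iff.2 (circle_sub_ne_zero ξ (norm_disc_lt_one w))
    rw [szegoSum_sub_szegoSum ζ a N (Circle.norm_coe ξ).le (norm_disc_lt_one w).le, enorm_mul,
      mul_pow, poissonKernel_zero_circle, mul_right_comm, ← ofReal_norm ((ξ : ℂ) - w),
      ← ENNReal.ofReal_pow hξw.le, ← ENNReal.ofReal_mul (by positivity),
      mul_div_cancel₀ _ (by positivity)]
  rw [lintegral_harmonicMeasure, lintegral_congr hcancel,
    lintegral_const_mul' _ _ ENNReal.ofReal_ne_top]
  calc ENNReal.ofReal (1 - ‖(w : ℂ)‖ ^ 2) *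
        ∫⁻ ξ : Circle, ‖szegoSum ζ (fun k => a k * u k) N ξ‖ₑ ^ 2 ∂circleMeasure
      ≤ ENNReal.ofReal (1 - ‖(w : ℂ)‖ ^ 2) *
          (3 * ∑ k ∈ Finset.range N, ‖a k * u k‖ₑ ^ 2 * ENNReal.ofReal (scale k)) := by
        gcongr
        exact lintegral_sum_radialSzego_le ζ _ N
    _ = 3 * ∑ k ∈ Finset.range N, ‖a k‖ₑ ^ 2 * ENNReal.ofReal (scale k) *
          (ENNReal.ofReal (1 - ‖(w : ℂ)‖ ^ 2) * ‖u k‖ₑ ^ 2) := by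
        rw [mul_left_comm, Finset.mul_sum]
        simp only [enorm_mul]
        congr 1
        exact Finset.sum_congr rfl fun k _ => by ring
    _ ≤ 3 * ∑ k ∈ Finset.range N, ‖a k‖ₑ ^ 2 * ENNReal.ofReal (scale k) *
          (9 * truncatedPoisson ζ (scale k) w) := by
        gcongr 3 * ∑ k ∈ Finset.range N, ‖a k‖ₑ ^ 2 * ENNReal.ofReal (scale k) * ?_ with k
        exact ofReal_one_sub_norm_sq_mul_enorm_szego_sq_le ζ k w
    _ = _ := by simp only [mul_left_comm _ (9 : ℝ≥0∞), ← Finset.mul_sum]; ring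

theorem energy_szegoSum_le (μ : Measure Disc) [SFinite μ] :
    energy μ (fun ξ => szegoSum ζ a N ξ) ≤ 108 * ∑ k ∈ Finset.range N,
      ‖a k‖ₑ ^ 2 * ENNReal.ofReal (scale k) * ∫⁻ w, truncatedPoisson ζ (scale k) w ∂μ := by
  have hf := (continuous_szegoSum ζ a N).measurable
  have hT := fun k => measurable_truncatedPoisson ζ (scale k)
  have hw : ∀ w : Disc, ∫⁻ ξ : Circle, ∫⁻ η : Circle,
      ‖szegoSum ζ a N η - szegoSum ζ a N ξ‖ₑ ^ 2 ∂harmonicMeasure w ∂harmonicMeasure w ≤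
      4 * (27 * ∑ k ∈ Finset.range N,
        ‖a k‖ₑ ^ 2 * ENNReal.ofReal (scale k) * truncatedPoisson ζ (scale k) w) := fun w =>
    (lintegral_lintegral_enorm_sub_sq_le _ hf _).trans
      (by gcongr; exact lintegral_szegoSum_sub_le ζ a N w)
  rw [energy_eq_lintegral_harmonicMeasure hf]
  refine (lintegral_mono hw).trans_eq ?_
  simp only [← mul_assoc (4 : ℝ≥0∞)]
  rw [lintegral_const_mul _ (by fun_prop), lintegral_finsetSum _ fun k _ => by fun_prop]
  norm_num only
  simp only [lintegral_const_mul _ (hT _)]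

theorem normSq_szegoSum_le (μ : Measure Disc) [SFinite μ] :
    normSq μ (fun ξ => szegoSum ζ a N ξ) ≤
      108 * ∑ k ∈ Finset.range N, ‖a k‖ₑ ^ 2 * conductance μ ζ k := by
  have hL2 : ∫⁻ ξ : Circle, ‖szegoSum ζ a N ξ‖ₑ ^ 2 ∂circleMeasure ≤
      108 * ∑ k ∈ Finset.range N, ‖a k‖ₑ ^ 2 * ENNReal.ofReal (scale k) :=
    (lintegral_sum_radialSzego_le ζ a N).trans (by gcongr; norm_num)
  refine (add_le_add hL2 (energy_szegoSum_le ζ a N μ)).trans_eq ?_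
  rw [← mul_add, ← Finset.sum_add_distrib]
  congr 1
  exact Finset.sum_congr rfl fun k _ => by rw [conductance]; ring

end UpperBound

theorem capacity_singleton_le_normSq (μ : Measure Disc) {ζ : Circle} {f : Circle → ℂ}
    (hf : Continuous f) (hfζ : 1 < ‖f ζ‖) : capacity μ {ζ} ≤ normSq μ f := by
  rcases eq_or_ne (normSq μ f) ∞ with htop | hfin
  · exact htop ▸ le_top
  · exact sInf_le ⟨f, ⟨hf.memLp_of_hasCompactSupport (.of_compactSpace _),
      (le_add_self.trans_lt hfin.lt_top : energy μ f < ∞)⟩,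
      ⟨{ξ | 1 < ‖f ξ‖}, isOpen_lt continuous_const hf.norm, singleton_subset_iff.2 hfζ,
        ae_of_all _ fun _ hξ => le_of_lt hξ⟩, rfl⟩

theorem exists_sum_eq_and_sum_enorm_sq_mul_eq {ι : Type*} {s : Finset ι} (hs : s.Nonempty)
    {C : ι → ℝ≥0∞} (hC0 : ∀ k, C k ≠ 0) (hCtop : ∀ k, C k ≠ ∞) (c : ℂ) :
    ∃ a : ι → ℂ, ∑ k ∈ s, a k = c ∧
      ∑ k ∈ s, ‖a k‖ₑ ^ 2 * C k = ‖c‖ₑ ^ 2 * (∑ k ∈ s, (C k)⁻¹)⁻¹ := by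
  lift C to ι → ℝ≥0 using hCtop
  have hC : ∀ k, C k ≠ 0 := fun k => ENNReal.coe_ne_zero.1 (hC0 k)
  let R : ℝ≥0 := ∑ k ∈ s, (C k)⁻¹
  have hR : R ≠ 0 := (Finset.sum_pos (fun k _ => inv_pos.2 (pos_of_ne_zero (hC k))) hs).ne'
  -- The minimizer is the equality case of the Cauchy–Schwarz inequality, `a k` proportional to
  -- `(C k)⁻¹`.
  refine ⟨fun k => c * (((C k)⁻¹ / R : ℝ≥0) : ℝ), ?_, ?_⟩
  · have hone : ∑ k ∈ s, (C k)⁻¹ / R = 1 := by rw [← Finset.sum_div, div_self hR]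
    rw [← Finset.mul_sum]
    exact_mod_cast (congrArg (fun r : ℝ≥0 => c * ((r : ℝ) : ℂ)) hone).trans (by simp)
  · have hterm : ∀ k, (‖c‖₊ * ((C k)⁻¹ / R)) ^ 2 * C k = ‖c‖₊ ^ 2 / R ^ 2 * (C k)⁻¹ := fun k => by
      have := hC k
      field_simp
    have hsum : ∑ k ∈ s, (‖c‖₊ * ((C k)⁻¹ / R)) ^ 2 * C k = ‖c‖₊ ^ 2 * R⁻¹ := by
      simp only [hterm, ← Finset.mul_sum]
      change ‖c‖₊ ^ 2 / R ^ 2 * R = _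
      field_simp
    have hnorm : ∀ r : ℝ≥0, ‖c * ((r : ℝ) : ℂ)‖ₑ = (‖c‖₊ * r : ℝ≥0) := fun r => by
      rw [enorm_eq_nnnorm, nnnorm_mul, Complex.nnnorm_real, NNReal.nnnorm_eq]
    simp only [hnorm, enorm_eq_nnnorm, ← ENNReal.coe_inv (hC _)]
    rw [← ENNReal.ofNNReal_finsetSum, ← ENNReal.coe_inv hR]
    exact_mod_cast hsum

theorem capacity_singleton_le_inv_sum {μ : Measure Disc} (hμ : RieszFinite μ) (ζ : Circle) (N : ℕ) :
    capacity μ {ζ} ≤ 432 * (∑ k ∈ Finset.range (N + 1), (conductance μ ζ k)⁻¹)⁻¹ := by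
  have := hμ.sigmaFinite
  obtain ⟨a, hsum, henergy⟩ := exists_sum_eq_and_sum_enorm_sq_mul_eq
    (Finset.nonempty_range_add_one (n := N)) (conductance_ne_zero μ ζ) (conductance_ne_top hμ ζ) 2
  have hvalue : szegoSum ζ a (N + 1) ζ = 2 := by
    simpa only [szegoSum, radialSzego_self, mul_one] using hsum
  calc capacity μ {ζ} ≤ normSq μ (fun ξ => szegoSum ζ a (N + 1) ξ) :=
        capacity_singleton_le_normSq μ (continuous_szegoSum ζ a (N + 1)) (by rw [hvalue]; norm_num)
    _ ≤ 108 * ∑ k ∈ Finset.range (N + 1), ‖a k‖ₑ ^ 2 * conductance μ ζ k :=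
        normSq_szegoSum_le ζ a (N + 1) μ
    _ = 432 * (∑ k ∈ Finset.range (N + 1), (conductance μ ζ k)⁻¹)⁻¹ := by
        have htwo : ‖(2 : ℂ)‖ₑ = 2 := by simp [enorm_eq_nnnorm]
        rw [henergy, htwo, ← mul_assoc]
        norm_num

theorem capacity_singleton_eq_zero_iff {μ : Measure Disc} (hμ : RieszFinite μ) (ζ : Circle) :
    capacity μ {ζ} = 0 ↔ ∑' k, (conductance μ ζ k)⁻¹ = ∞ := by
  refine ⟨fun h0 => of_not_not fun hR => capacity_singleton_ne_zero hμ ζ hR h0, fun hR => ?_⟩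
  have hsum : Tendsto (fun N => ∑ k ∈ Finset.range (N + 1), (conductance μ ζ k)⁻¹) atTop (𝓝 ∞) :=
    hR ▸ (tendsto_add_atTop_iff_nat 1).2 (ENNReal.tendsto_nat_tsum _)
  have hbound : Tendsto
      (fun N => 432 * (∑ k ∈ Finset.range (N + 1), (conductance μ ζ k)⁻¹)⁻¹) atTop (𝓝 0) := by
    simpa using ENNReal.Tendsto.const_mul (tendsto_inv_iff.2 hsum) (.inr (by simp))
  exact nonpos_iff_eq_zero.1
    (ge_of_tendsto' hbound (capacity_singleton_le_inv_sum hμ ζ))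

end DirichletCapacity

end

theorem corollary4p3 (μ : MeasureTheory.Measure DirichletCapacity.Disc)
    (hμ : DirichletCapacity.RieszFinite μ) (ζ : Circle) :
    DirichletCapacity.capacity μ {ζ} = 0 ↔
      ∫⁻ r in Set.Ioo (0 : ℝ) 1,
        (ENNReal.ofReal (1 - r) * DirichletCapacity.V μ ((r : ℂ) * (ζ : ℂ))
          + ENNReal.ofReal ((1 - r) ^ 2))⁻¹ = ∞ := by
  rw [DirichletCapacity.capacity_singleton_eq_zero_iff hμ,
    ← DirichletCapacity.lintegral_inv_radialWeight_eq_top_iff]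
  simp only [DirichletCapacity.radialWeight, DirichletCapacity.radialPoint, sub_sub_cancel]
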